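/- **Proposition 3.3.** Let $n \ge 1$, and let $\mathcal B_n \subseteq [0,1]^{n\times n}$ be the Birkhoff polytope, i.e. the set of doubly stochastic $n \times n$ matrices. Identify a permutation $\pi \in S_n$ with its permutation matrix, whose $(i,j)$ entry is $1$ if $j=\pi(i)$ and $0$ otherwise. Fix a root $r \in [n]$. An arborescence on $[n]$ rooted at $r$ is a set $T$ of directed edges on $[n]$ such that from every vertex there is exactly one directed walk to $r$; let $\mathcal T_r(n)$ be the set of all of them. For $\pi \in S_n$ put $$P_\pi(x) = \prod_{i=1}^n x_{i,\pi(i)} \sum_{T \in \mathcal T_r(n)} \ \prod_{(u,v)\in T} x_{u,\pi(v)} .$$ 1. For every $x \in \mathcal B_n$, $$\sum_{\pi\in S_n} (\pi - x)\, P_\pi(x) = 0 .$$ 2. Consider the following procedure, which has access to independent flips of a coin of (unknown) bias $x_{ij}$ for every $(i,j)\in[n]^2$, and to coins of known constant bias: *pick a uniformly random permutation $\pi$ of $[n]$; flip the $x_{i,\pi(i)}$-coin for each $i\in[n]$, and restart if one of them shows $0$; pick a uniformly random spanning tree of the complete graph $K_n$ and let $T$ be the set of its edges, oriented toward $r$;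 flip the $x_{u,\pi(v)}$-coin for each $(u,v)\in T$, and restart if one of them shows $0$; otherwise output $\pi$.* Written as a (possibly infinite) binary decision tree, whose inner nodes are labelled with the coins flipped and whose leaves are labelled with the outputs, it is a Bernoulli race over the weights $P_\pi$: for every $x \in \mathcal B_n$ with $\sum_{\sigma} P_\sigma(x) > 0$ it outputs each $\pi \in S_n$ with probability $P_\pi(x)/\sum_{\sigma\in S_n} P_\sigma(x)$. 3. This procedure is a Bernoulli factory for $\mathcal B_n$, that is, for perfect matchings of $K_{n,n}$: its outputs are the vertices of $\mathcal B_n$ (the permutation matrices), and for every $x\in\mathcal B_n$ all of whose entries lie in $(0,1)$ it terminates almost surely, and the expectation of the permutation matrix that it outputs is $x$. -/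

import Mathlib

noncomputable section

open scoped Classical

namespace MatchingFactory

/-! ### Bernoulli factories as decision trees -/

/-- The label of an inner node: either one of the coins with unknown bias, indexed by `ι`,
or a coin with a known constant bias in the open interval `(0, 1)`. -/
inductive Coin (ι : Type) : Type
  | var (i : ι) : Coin ι
  | const (c : Set.Ioo (0 : ℝ) 1) : Coin ι

/-- The probability that a coin shows `1`, given the biases `x` of the unknown coins. -/
def Coin.bias {ι : Type} (x : ι → ℝ) : Coin ι → ℝ
  | .var i => x i
  | .const c => c

/-- What is written at a node of a decision tree: a leaf carries an output, any other node
carries the coin that is flipped there. -/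
inductive Node (ι V : Type) : Type
  | leaf (v : V) : Node ι V
  | flip (c : Coin ι) : Node ι V

/-- A Bernoulli factory with coins `ι` and outputs in `V`: a possibly infinite rooted binary
tree with labels. A node is addressed by the list of coin results on the way from the root to it
(the root is `[]`, and the first entry is the result of the first flip), and `F w` is what is
written at the address `w`. Addresses that extend the address of a leaf are not nodes of the
tree, and what is written there is never read. -/
def Factory (ι V : Type) : Type := List Bool → Node ι V

/-- The subtree below the edge with label `b` out of the root. -/
def Factory.child {ι V : Type} (F : Factory ι V) (b : Bool) : Factory ι V := fun w => F (b :: w)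

/-- The probability that the factory, run with coins of biases `x`, reaches a leaf labelled `v`
after at most `k` coin flips. -/
def Factory.probWithin {ι V : Type} (x : ι → ℝ) (v : V) : ℕ → Factory ι V → ℝ
  | 0, F =>
    match F [] with
    | .leaf u => if u = v then 1 else 0
    | .flip _ => 0
  | k + 1, F =>
    match F [] with
    | .leaf u => if u = v then 1 else 0
    | .flip c => c.bias x * Factory.probWithin x v k (F.child true)
        + (1 - c.bias x) * Factory.probWithin x v k (F.child false)

/-- The probability that the factory outputs `v`. For biases in `[0, 1]` the sequence
`k ↦ probWithin x v k F` is nondecreasing and bounded by `1`, so this is its limit. -/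
def Factory.prob {ι V : Type} (F : Factory ι V) (x : ι → ℝ) (v : V) : ℝ :=
  ⨆ k : ℕ, Factory.probWithin x v k F

/-- The factory terminates with probability `1` when run with coins of biases `x`. -/
def Factory.TerminatesAt {ι V : Type} [Fintype V] (F : Factory ι V) (x : ι → ℝ) : Prop :=
  ∑ v, F.prob x v = 1

/-- `F` is a Bernoulli factory for the polytope `P` of `m × n` matrices, whose vertices are
enumerated by `vert : V → P`: on every point `x` of `P` with all entries in `(0, 1)`, the factory,
which has access to one coin of bias `x i j` for every pair `(i, j)`, terminates almost surely and
the expectation of the vertex that it outputs is `x`. -/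
structure IsBernoulliFactoryFor {m n V : Type} [Fintype V] (P : Set (Matrix m n ℝ))
    (vert : V → Matrix m n ℝ) (F : Factory (m × n) V) : Prop where
  vert_injective : Function.Injective vert
  range_vert : Set.range vert = P.extremePoints ℝ
  terminates : ∀ x ∈ P, (∀ i j, x i j ∈ Set.Ioo (0 : ℝ) 1) →
    F.TerminatesAt (fun e => x e.1 e.2)
  expectation : ∀ x ∈ P, (∀ i j, x i j ∈ Set.Ioo (0 : ℝ) 1) →
    ∑ v, F.prob (fun e => x e.1 e.2) v • vert v = x

/-! ### Finite decision trees and the Bernoulli race -/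

/-- Finite decision trees, i.e. finite factories. -/
inductive FinTree (ι A : Type) : Type
  | leaf (a : A) : FinTree ι A
  | flip (c : Coin ι) (one zero : FinTree ι A) : FinTree ι A

/-- Run a tree, then continue with a tree that depends on its output. -/
def FinTree.bind {ι A B : Type} : FinTree ι A → (A → FinTree ι B) → FinTree ι B
  | .leaf a, f => f a
  | .flip c t₁ t₀, f => .flip c (t₁.bind f) (t₀.bind f)

/-- A uniformly random entry of the list `a :: l`: with probability `1 / (length of a :: l)` the
entry `a`, otherwise a uniformly random entry of `l`. -/
def FinTree.uniformList {ι A : Type} : A → List A → FinTree ι A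
  | a, [] => .leaf a
  | a, b :: l => .flip
      (.const ⟨1 / ((l.length : ℝ) + 2), by positivity,
        by rw [div_lt_one (by positivity)]; linarith [(Nat.cast_nonneg l.length : (0 : ℝ) ≤ _)]⟩)
      (.leaf a) (FinTree.uniformList b l)

/-- A uniformly random element of a nonempty finite set. -/
def FinTree.uniform {ι A : Type} (s : Finset A) (hs : s.Nonempty) : FinTree ι A :=
  FinTree.uniformList hs.choose (s.erase hs.choose).toList

/-- Flip the unknown coins in the list one after the other. As soon as one of them shows `0`,
stop with `false`; if all of them show `1`, output `true`. -/
def FinTree.allOnes {ι : Type} : List ι → FinTree ι Bool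
  | [] => .leaf true
  | i :: l => .flip (.var i) (FinTree.allOnes l) (.leaf false)

/-- The coin flipped at the root of a round, or its output. A round that consists of the single
leaf `none` would be repeated for ever without flipping a coin; as a tree needs a label there, a
fair coin is flipped instead in that degenerate case, and the loop still never terminates. -/
def FinTree.rootNode {ι V : Type} : FinTree ι (Option V) → Node ι V
  | .leaf (some v) => .leaf v
  | .leaf none => .flip (.const ⟨1 / 2, by norm_num, by norm_num⟩)
  | .flip c _ _ => .flip c

/-- The subtree entered after the result `b` of the flip at the root. -/
def FinTree.next {ι A : Type} (b : Bool) : FinTree ι A → FinTree ι A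
  | .leaf a => .leaf a
  | .flip _ t₁ t₀ => if b then t₁ else t₀

/-- If the current round `s` has ended with `none`, start a new round `t`. -/
def FinTree.resume {ι V : Type} (t : FinTree ι (Option V)) :
    FinTree ι (Option V) → FinTree ι (Option V)
  | .leaf none => t
  | s => s

/-- Go on with rounds `t`, from the position `s` within the current round. -/
def FinTree.loopFrom {ι V : Type} (t : FinTree ι (Option V)) :
    FinTree ι (Option V) → Factory ι V
  | s, [] => (t.resume s).rootNode
  | s, b :: w => FinTree.loopFrom t ((t.resume s).next b) w

/-- Repeat the round `t` until it ends with `some v`, and then output `v`. -/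
def FinTree.loop {ι V : Type} (t : FinTree ι (Option V)) : Factory ι V := t.loopFrom t

/-- The Bernoulli race: pick a uniformly random `v : V` and run the one-bit factory `f v`; if it
returns `true` then output `v`, otherwise restart. -/
def race {ι V : Type} [Fintype V] [Nonempty V] (f : V → FinTree ι Bool) : Factory ι V :=
  ((FinTree.uniform Finset.univ Finset.univ_nonempty).bind fun v =>
    (f v).bind fun b => .leaf (if b then some v else none)).loop

/-! ### Arborescences and the polynomials -/

/-- The directed graph on the vertices `Fin n` with edge set `T` is an arborescence rooted at `r`:
from every vertex `v` there is exactly one directed walk to `r`. A walk from `v` is given by the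
list `l` of the vertices that it visits after `v`. -/
def IsArborescence {n : ℕ} (r : Fin n) (T : Finset (Fin n × Fin n)) : Prop :=
  ∀ v : Fin n, ∃! l : List (Fin n),
    List.IsChain (fun a b => (a, b) ∈ T) (v :: l) ∧ (v :: l).getLast (List.cons_ne_nil v l) = r

/-- The set of all arborescences rooted at `r` on the vertices `Fin n`. -/
def arborescences {n : ℕ} (r : Fin n) : Finset (Finset (Fin n × Fin n)) :=
  Finset.univ.filter (IsArborescence r)

/-- The value at `x` of the polynomial
`P_π(x) = ∏ i, x_{i, π(i)} * ∑ T, ∏ (u, v) ∈ T, x_{u, π(v)}`,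
where `T` runs over the arborescences rooted at `r`. -/
def matchingPoly {n : ℕ} (r : Fin n) (π : Equiv.Perm (Fin n)) (x : Matrix (Fin n) (Fin n) ℝ) : ℝ :=
  (∏ i, x i (π i)) * ∑ T ∈ arborescences r, ∏ e ∈ T, x e.1 (π e.2)

/-! ### The factory for perfect matchings -/

/-- The set of spanning trees of the complete graph on `Fin n`. -/
def spanningTrees (n : ℕ) : Finset (SimpleGraph (Fin n)) :=
  Finset.univ.filter fun G => G.IsTree

theorem spanningTrees_nonempty {n : ℕ} (r : Fin n) : (spanningTrees n).Nonempty := by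
  have : Nonempty (Fin n) := ⟨r⟩
  obtain ⟨G, -, hG⟩ := (SimpleGraph.connected_top (V := Fin n)).exists_isTree_le
  exact ⟨G, by simpa [spanningTrees] using hG⟩

/-- The edges of the tree `G`, oriented toward `r`: every edge points to its endpoint that is
closer to `r` in the tree. -/
def orientToward {n : ℕ} (r : Fin n) (G : SimpleGraph (Fin n)) : Finset (Fin n × Fin n) :=
  Finset.univ.filter fun e => G.Adj e.1 e.2 ∧ G.dist e.2 r < G.dist e.1 r

/-- The trial for the permutation `π`: flip the coin `(i, π i)` for every `i`; if all of them show
`1`, pick a uniformly random spanning tree of the complete graph, orient it toward `r`, and flip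
the coin `(u, π v)` for every directed edge `(u, v)` of it. Succeed if all coins show `1`. -/
def matchingTrial {n : ℕ} (r : Fin n) (π : Equiv.Perm (Fin n)) : FinTree (Fin n × Fin n) Bool :=
  (FinTree.allOnes ((List.finRange n).map fun i => (i, π i))).bind fun ok =>
    if ok then
      (FinTree.uniform (spanningTrees n) (spanningTrees_nonempty r)).bind fun G =>
        FinTree.allOnes ((orientToward r G).toList.map fun e => (e.1, π e.2))
    else .leaf false

/-- The Bernoulli factory for perfect matchings: pick a uniformly random permutation `π`, run its
trial, output `π` if the trial succeeds, and restart otherwise. -/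
def matchingFactory {n : ℕ} (r : Fin n) : Factory (Fin n × Fin n) (Equiv.Perm (Fin n)) :=
  race (matchingTrial r)

end MatchingFactory

end

noncomputable section

open scoped Classical

namespace MatchingFactory

/-! ### Output distributions of finite trees and of the Bernoulli race -/

/-! Entrywise, the vector equality says that `x i j` times the sum of all weights is the sum of the
weights of those permutations with `π i = j`. Take the root to be `i` first. An arborescence rooted
at `i` together with one edge out of `i` is a function `f` under which every vertex eventually
reaches `i`; its only cycle passes through `i`. On the left, `x i j` is the weight of the added edge
from `i` to `π⁻¹ j`. On the right, row `i` sums to 1, so an arbitrary edge out of `i` may be added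
without changing the sum. Both sides then sum the same weight, the product over `u` of `x u (π u) *
x u (π (f u))`, over pairs `(π, f)`, subject to `π (f i) = j` on the left and `π i = j` on the
right.

An involution matches the pairs: with `c` the cycle of `f`, replace `π` by `π * c`, reverse the
cycle of `f`, and let each edge entering the cycle end at the predecessor of its old endpoint. For
`u` on the cycle the two factors are exchanged, for all other `u` they are unchanged, and the two
conditions at `i` are exchanged (`sum_swap_reverseCycle`).

The fixed root `r` is then traded for `i`. By the Markov chain tree theorem the tree sums are a
stationary measure of the chain with transition matrix `x u (π v)`. This matrix is doubly
stochastic, so if it is positive the maximum principle makes the tree sums constant in the root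
(`treeSum_eq_of_pos`). Continuity extends the identity from positive matrices to the whole polytope.

For the factory, the success probability of one trial is `P_π` divided by the number of spanning
trees, because orienting toward `r` is a bijection from spanning trees to arborescences. Repeating
rounds until success normalises these numbers, and the constant cancels. Dividing the vector
equality by the positive total weight gives the expectation. -/

/-- The probability that the finite tree outputs `a`. -/
def FinTree.outProb {ι A : Type} (x : ι → ℝ) (a : A) : FinTree ι A → ℝ
  | .leaf b => if b = a then 1 else 0
  | .flip c t₁ t₀ => c.bias x * t₁.outProb x a + (1 - c.bias x) * t₀.outProb x a

theorem FinTree.sum_outProb {ι A : Type} [Fintype A] (x : ι → ℝ) (t : FinTree ι A) :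
    ∑ a, t.outProb x a = 1 := by
  induction t with
  | leaf b => simp [outProb]
  | flip c t₁ t₀ h₁ h₀ =>
    simp only [outProb, Finset.sum_add_distrib, ← Finset.mul_sum, h₁, h₀]
    ring

theorem FinTree.outProb_bind {ι A B : Type} [Fintype A] (x : ι → ℝ) (t : FinTree ι A)
    (f : A → FinTree ι B) (b : B) :
    (t.bind f).outProb x b = ∑ a, t.outProb x a * (f a).outProb x b := by
  induction t with
  | leaf a => simp [outProb, bind]
  | flip c t₁ t₀ h₁ h₀ =>
    simp only [outProb, bind, h₁, h₀, Finset.mul_sum, ← Finset.sum_add_distrib]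
    exact Finset.sum_congr rfl fun a _ => by ring

/-- Induction on the list: an entry of the tail is reached with the complementary probability `1 -
1/(m+2)` and then has probability `1/(m+1)`, with product `1/(m+2)`, where `m` is the length of the
inner list. -/
theorem FinTree.outProb_uniformList {ι A : Type} (x : ι → ℝ) (v a : A) (l : List A)
    (h : (a :: l).Nodup) :
    (uniformList a l : FinTree ι A).outProb x v =
      if v ∈ a :: l then 1 / ((l.length : ℝ) + 1) else 0 := by
  induction l generalizing a with
  | nil => simp [uniformList, outProb, eq_comm]
  | cons b l ih =>
    rw [uniformList, outProb, ih b h.of_cons]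
    have hne : (l.length : ℝ) + 1 ≠ 0 := by positivity
    have hne' : (l.length : ℝ) + 2 ≠ 0 := by positivity
    have hne'' : (l.length : ℝ) + 1 + 1 ≠ 0 := by positivity
    by_cases hva : a = v
    · subst hva
      have : a ∉ b :: l := (List.nodup_cons.mp h).1
      simp only [outProb, Coin.bias, this, List.mem_cons_self, if_true, if_false,
        List.length_cons]
      push_cast
      field_simp
      ring
    · have hav : ¬ v = a := fun h => hva h.symm
      by_cases hm : v ∈ b :: l
      · simp only [outProb, Coin.bias, hm, hva, List.mem_cons_of_mem a hm, if_true, if_false,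
          List.length_cons]
        push_cast
        field_simp
        ring
      · have : v ∉ a :: b :: l := by simp_all
        simp only [outProb, hm, hva, this, if_false]
        ring

theorem FinTree.outProb_uniform {ι A : Type} (x : ι → ℝ) (s : Finset A) (hs : s.Nonempty)
    (v : A) :
    (uniform s hs : FinTree ι A).outProb x v = if v ∈ s then 1 / (s.card : ℝ) else 0 := by
  have hc := hs.choose_spec
  have hnd : (hs.choose :: (s.erase hs.choose).toList).Nodup := by
    simp [Finset.nodup_toList]
  have hmem : v ∈ hs.choose :: (s.erase hs.choose).toList ↔ v ∈ s := by
    simp only [List.mem_cons, Finset.mem_toList, Finset.mem_erase]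
    constructor
    · rintro (rfl | h)
      exacts [hc, h.2]
    · intro h
      by_cases hv : v = hs.choose
      exacts [Or.inl hv, Or.inr ⟨hv, h⟩]
  rw [uniform, outProb_uniformList x v _ _ hnd]
  simp only [hmem]
  have : ((s.erase hs.choose).toList.length : ℝ) + 1 = s.card := by
    rw [Finset.length_toList]
    exact_mod_cast Finset.card_erase_add_one hc
  rw [this]

theorem FinTree.outProb_allOnes {ι : Type} (x : ι → ℝ) (l : List ι) :
    (allOnes l).outProb x true = (l.map x).prod := by
  induction l with
  | nil => simp [allOnes, outProb]
  | cons i l ih => simp [allOnes, outProb, ih, Coin.bias]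

theorem Coin.bias_nonneg {ι : Type} {x : ι → ℝ} (hx : ∀ i, x i ∈ Set.Icc (0 : ℝ) 1)
    (c : Coin ι) : 0 ≤ c.bias x := by
  cases c with
  | var i => exact (hx i).1
  | const c => exact c.2.1.le

theorem Coin.bias_le_one {ι : Type} {x : ι → ℝ} (hx : ∀ i, x i ∈ Set.Icc (0 : ℝ) 1)
    (c : Coin ι) : c.bias x ≤ 1 := by
  cases c with
  | var i => exact (hx i).2
  | const c => exact c.2.2.le

theorem Factory.probWithin_of_leaf {ι V : Type} (x : ι → ℝ) (v : V) {F : Factory ι V} {u : V}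
    (h : F [] = .leaf u) (k : ℕ) : F.probWithin x v k = if u = v then 1 else 0 := by
  cases k <;> simp [probWithin, h]

theorem Factory.probWithin_zero_of_flip {ι V : Type} (x : ι → ℝ) (v : V) {F : Factory ι V}
    {c : Coin ι} (h : F [] = .flip c) : F.probWithin x v 0 = 0 := by
  simp [probWithin, h]

theorem Factory.probWithin_succ_of_flip {ι V : Type} (x : ι → ℝ) (v : V) {F : Factory ι V}
    {c : Coin ι} (h : F [] = .flip c) (k : ℕ) :
    F.probWithin x v (k + 1) = c.bias x * (F.child true).probWithin x v k
      + (1 - c.bias x) * (F.child false).probWithin x v k := by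
  simp [probWithin, h]

theorem Factory.probWithin_mem_Icc {ι V : Type} {x : ι → ℝ} (hx : ∀ i, x i ∈ Set.Icc (0 : ℝ) 1)
    (v : V) (k : ℕ) (F : Factory ι V) : F.probWithin x v k ∈ Set.Icc (0 : ℝ) 1 := by
  induction k generalizing F with
  | zero =>
    cases h : F [] with
    | leaf u => rw [probWithin_of_leaf x v h]; split_ifs <;> simp
    | flip c => rw [probWithin_zero_of_flip x v h]; simp
  | succ k ih =>
    cases h : F [] with
    | leaf u => rw [probWithin_of_leaf x v h]; split_ifs <;> simp
    | flip c =>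
      rw [probWithin_succ_of_flip x v h]
      exact (convex_Icc (0 : ℝ) 1) (ih _) (ih _) (c.bias_nonneg hx)
        (sub_nonneg.mpr (c.bias_le_one hx)) (by ring)

theorem Factory.probWithin_le_succ {ι V : Type} {x : ι → ℝ} (hx : ∀ i, x i ∈ Set.Icc (0 : ℝ) 1)
    (v : V) (k : ℕ) (F : Factory ι V) : F.probWithin x v k ≤ F.probWithin x v (k + 1) := by
  induction k generalizing F with
  | zero =>
    cases h : F [] with
    | leaf u => simp only [probWithin_of_leaf x v h, le_refl]
    | flip c =>
      rw [probWithin_zero_of_flip x v h]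
      exact (probWithin_mem_Icc hx v _ F).1
  | succ k ih =>
    cases h : F [] with
    | leaf u => simp only [probWithin_of_leaf x v h, le_refl]
    | flip c =>
      rw [probWithin_succ_of_flip x v h, probWithin_succ_of_flip x v h]
      exact add_le_add (mul_le_mul_of_nonneg_left (ih _) (c.bias_nonneg hx))
        (mul_le_mul_of_nonneg_left (ih _) (sub_nonneg.mpr (c.bias_le_one hx)))

/-- Being a limit rather than just a supremum, `prob` inherits the one-step recursion of
`probWithin`. -/
theorem Factory.tendsto_probWithin {ι V : Type} {x : ι → ℝ}
    (hx : ∀ i, x i ∈ Set.Icc (0 : ℝ) 1) (v : V) (F : Factory ι V) :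
    Filter.Tendsto (fun k => F.probWithin x v k) Filter.atTop (nhds (F.prob x v)) :=
  tendsto_atTop_ciSup (monotone_nat_of_le_succ fun k => probWithin_le_succ hx v k F)
    ⟨1, by rintro _ ⟨k, rfl⟩; exact (probWithin_mem_Icc hx v k F).2⟩

theorem Factory.prob_of_leaf {ι V : Type} (x : ι → ℝ) (v : V) {F : Factory ι V} {u : V}
    (h : F [] = .leaf u) : F.prob x v = if u = v then 1 else 0 := by
  simp only [prob, probWithin_of_leaf x v h, ciSup_const]

theorem Factory.prob_of_flip {ι V : Type} {x : ι → ℝ} (hx : ∀ i, x i ∈ Set.Icc (0 : ℝ) 1)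
    (v : V) {F : Factory ι V} {c : Coin ι} (h : F [] = .flip c) :
    F.prob x v = c.bias x * (F.child true).prob x v
      + (1 - c.bias x) * (F.child false).prob x v := by
  refine tendsto_nhds_unique ((Filter.tendsto_add_atTop_iff_nat 1).mpr
    (tendsto_probWithin hx v F)) ?_
  simp only [probWithin_succ_of_flip x v h]
  exact ((tendsto_probWithin hx v _).const_mul _).add ((tendsto_probWithin hx v _).const_mul _)

/-- A failed round is replaced by a fresh one before any label is read. This stays true in the
degenerate case `t = .leaf none`, where resuming gives back `t`. -/
theorem FinTree.loopFrom_leaf_none {ι V : Type} (t : FinTree ι (Option V)) :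
    t.loopFrom (.leaf none) = t.loop := by
  have h : t.resume t = t := by
    match t with
    | .leaf none => rfl
    | .leaf (some v) => rfl
    | .flip _ _ _ => rfl
  funext w
  cases w <;> simp only [loop, loopFrom, h] <;> rfl

theorem FinTree.prob_loopFrom {ι V : Type} {x : ι → ℝ} (hx : ∀ i, x i ∈ Set.Icc (0 : ℝ) 1)
    (v : V) (t s : FinTree ι (Option V)) :
    (t.loopFrom s).prob x v = s.outProb x (some v) + s.outProb x none * t.loop.prob x v := by
  induction s with
  | leaf o =>
    cases o with
    | none => simp [loopFrom_leaf_none, outProb]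
    | some u =>
      rw [Factory.prob_of_leaf x v (show t.loopFrom (.leaf (some u)) [] = .leaf u from rfl)]
      simp [outProb]
  | flip c s₁ s₀ h₁ h₀ =>
    rw [Factory.prob_of_flip hx v (show t.loopFrom (.flip c s₁ s₀) [] = .flip c from rfl)]
    change c.bias x * (t.loopFrom s₁).prob x v + (1 - c.bias x) * (t.loopFrom s₀).prob x v = _
    rw [h₁, h₀]
    simp only [outProb]
    ring

/-- Repeating a round until it succeeds conditions its output distribution on success. -/
theorem FinTree.prob_loop {ι V : Type} [Fintype V] {x : ι → ℝ}
    (hx : ∀ i, x i ∈ Set.Icc (0 : ℝ) 1) (t : FinTree ι (Option V))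
    (ht : 0 < ∑ u, t.outProb x (some u)) (v : V) :
    t.loop.prob x v = t.outProb x (some v) / ∑ u, t.outProb x (some u) := by
  -- Renewal equation: if `p` is the sought probability, then `p = P(v) + P(none) * p`. Since `1 -
  -- P(none)` is the positive success probability of a round, no geometric series is needed.
  have h := prob_loopFrom hx v t t
  have hs := t.sum_outProb x
  rw [Fintype.sum_option] at hs
  change t.loop.prob x v = _ at h
  rw [eq_div_iff ht.ne']
  linear_combination h + t.loop.prob x v * hs

theorem FinTree.outProb_raceRound {ι V : Type} [Fintype V] [Nonempty V] (x : ι → ℝ)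
    (f : V → FinTree ι Bool) (v : V) :
    ((uniform Finset.univ Finset.univ_nonempty).bind fun v =>
      (f v).bind fun b => .leaf (if b then some v else none) :
        FinTree ι (Option V)).outProb x (some v) =
      1 / (Fintype.card V : ℝ) * (f v).outProb x true := by
  rw [outProb_bind, Finset.sum_eq_single v]
  · rw [outProb_uniform, outProb_bind]
    simp [outProb]
  · intro u _ hu
    rw [outProb_bind]
    simp [outProb, hu]
  · simp

/-- The Bernoulli race outputs `v` with probability proportional to the success probability of
the trial for `v`. -/
theorem prob_race {ι V : Type} [Fintype V] [Nonempty V] {x : ι → ℝ}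
    (hx : ∀ i, x i ∈ Set.Icc (0 : ℝ) 1) (f : V → FinTree ι Bool)
    (hf : 0 < ∑ u, (f u).outProb x true) (v : V) :
    (race f).prob x v = (f v).outProb x true / ∑ u, (f u).outProb x true := by
  have hc : (0 : ℝ) < 1 / (Fintype.card V : ℝ) := by
    have := Fintype.card_pos (α := V)
    positivity
  rw [race, FinTree.prob_loop hx]
  · simp only [FinTree.outProb_raceRound, ← Finset.mul_sum]
    rw [mul_div_mul_left _ _ hc.ne']
  · simp only [FinTree.outProb_raceRound, ← Finset.mul_sum]
    positivity

/-! ### Functional graphs and the Markov chain tree theorem -/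

/-- Iterating `f` leads from every point to `r`. -/
def ReachedFromAll {α : Type} (f : α → α) (r : α) : Prop := ∀ v, ∃ k, f^[k] v = r

/-- Up to its first arrival at `r`, an orbit uses only values away from `r`; hence the value at `r`
can be altered freely. -/
theorem exists_iterate_eq_of_eqOn_ne {α : Type} {f g : α → α} {r : α} (h : ∀ v, v ≠ r → f v = g v)
    (k : ℕ) (v : α) (hv : f^[k] v = r) : ∃ m, g^[m] v = r := by
  induction k generalizing v with
  | zero => exact ⟨0, hv⟩
  | succ k ih =>
    by_cases hvr : v = r
    · exact ⟨0, hvr⟩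
    · obtain ⟨m, hm⟩ := ih (f v) hv
      exact ⟨m + 1, by rwa [Function.iterate_succ_apply, ← h v hvr]⟩

theorem ReachedFromAll.congr {α : Type} {f g : α → α} {r : α} (hf : ReachedFromAll f r)
    (h : ∀ v, v ≠ r → f v = g v) : ReachedFromAll g r := fun v => by
  obtain ⟨k, hk⟩ := hf v
  exact exists_iterate_eq_of_eqOn_ne h k v hk

theorem ReachedFromAll.update {α : Type} {f : α → α} {r : α} (hf : ReachedFromAll f r) (s : α) :
    ReachedFromAll (Function.update f r s) r :=
  hf.congr fun v hv => by simp [hv]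

theorem ReachedFromAll.trans {α : Type} {f : α → α} {r : α} (hf : ReachedFromAll f r) (k : ℕ) :
    ReachedFromAll f (f^[k] r) := fun v => by
  obtain ⟨m, hm⟩ := hf v
  exact ⟨k + m, by rw [Function.iterate_add_apply, hm]⟩

theorem ReachedFromAll.apply {α : Type} {f : α → α} {r : α} (hf : ReachedFromAll f r) :
    ReachedFromAll f (f r) := hf.trans 1

theorem ReachedFromAll.mem_periodicPts {α : Type} {f : α → α} {r : α}
    (hf : ReachedFromAll f r) : r ∈ Function.periodicPts f := by
  obtain ⟨k, hk⟩ := hf (f r)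
  exact ⟨k + 1, k.succ_pos, hk⟩

/-- The point sought is the predecessor of `s` on the cycle through `s`. It is unique because a
point reached from everywhere is periodic and `f` is injective on periodic points. -/
theorem ReachedFromAll.existsUnique_pred {α : Type} {f : α → α} {s : α}
    (hf : ReachedFromAll f s) : ∃! r, ReachedFromAll f r ∧ f r = s := by
  obtain ⟨k, hk⟩ := hf (f s)
  refine ⟨f^[k] s, ⟨hf.trans k, ?_⟩, ?_⟩
  · rwa [← Function.iterate_succ_apply' f, Function.iterate_succ_apply]
  · rintro t ⟨ht, hts⟩
    refine (Function.bijOn_periodicPts f).injOn ht.mem_periodicPts (hf.trans k).mem_periodicPts ?_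
    rw [hts, ← Function.iterate_succ_apply' f, Function.iterate_succ_apply, hk]

/-- The total weight of the trees on `α` directed toward `r`, a tree being given by the function
that sends every vertex to the next one on the way to `r`. -/
def treeSum {α : Type} [Fintype α] (w : α → α → ℝ) (r : α) : ℝ :=
  ∑ f : α → α with ReachedFromAll f r ∧ f r = r, ∏ u ∈ Finset.univ.erase r, w u (f u)

/-- Adding the edge from `r` to `s` turns a tree directed toward `r` into a function whose only
cycle passes through `r`; resetting the value at `r` undoes this. -/
theorem treeSum_mul {α : Type} [Fintype α] (w : α → α → ℝ) (r s : α) :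
    treeSum w r * w r s =
      ∑ f : α → α with ReachedFromAll f r ∧ f r = s, ∏ u, w u (f u) := by
  rw [treeSum, Finset.sum_mul]
  refine Finset.sum_nbij' (fun f => Function.update f r s) (fun f => Function.update f r r)
    ?_ ?_ ?_ ?_ ?_
  · intro f hf
    simp only [Finset.mem_filter, Finset.mem_univ, true_and] at hf ⊢
    exact ⟨hf.1.update s, by simp⟩
  · intro f hf
    simp only [Finset.mem_filter, Finset.mem_univ, true_and] at hf ⊢
    exact ⟨hf.1.update r, by simp⟩
  · intro f hf
    simp only [Finset.mem_filter, Finset.mem_univ, true_and] at hf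
    rw [Function.update_idem, Function.update_eq_self_iff, hf.2]
  · intro f hf
    simp only [Finset.mem_filter, Finset.mem_univ, true_and] at hf
    rw [Function.update_idem, Function.update_eq_self_iff, hf.2]
  · intro f _
    rw [← Finset.prod_erase_mul _ _ (Finset.mem_univ r), Function.update_self]
    congr 1
    exact Finset.prod_congr rfl fun u hu => by
      rw [Function.update_of_ne (Finset.ne_of_mem_erase hu)]

theorem treeSum_mul_sum {α : Type} [Fintype α] (w : α → α → ℝ) (s : α) :
    treeSum w s * ∑ v, w s v = ∑ f : α → α with ReachedFromAll f s, ∏ u, w u (f u) := by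
  simp only [Finset.mul_sum, treeSum_mul, ← Finset.filter_filter]
  exact Finset.sum_fiberwise _ (fun f : α → α => f s) _

/-- Each function with `s` on its cycle is counted exactly once, by the `r` that precedes `s` on the
cycle. Cutting instead the edge that leaves `s` gives `treeSum_mul_sum`; comparing the two yields
stationarity. -/
theorem sum_treeSum_mul {α : Type} [Fintype α] (w : α → α → ℝ) (s : α) :
    ∑ r, treeSum w r * w r s = ∑ f : α → α with ReachedFromAll f s, ∏ u, w u (f u) := by
  simp only [treeSum_mul, Finset.sum_filter]
  rw [Finset.sum_comm]
  refine Finset.sum_congr rfl fun f _ => ?_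
  split_ifs with hf
  · obtain ⟨r, hr, huniq⟩ := hf.existsUnique_pred
    rw [Finset.sum_eq_single r, if_pos hr]
    · intro t _ htr
      exact if_neg fun ht => htr (huniq t ht)
    · simp
  · refine Finset.sum_eq_zero fun r _ => if_neg ?_
    rintro ⟨hr, rfl⟩
    exact hf hr.apply

/-- **Markov chain tree theorem**: `treeSum w` is a stationary measure of the chain `w`. -/
theorem sum_treeSum_mul_eq {α : Type} [Fintype α] {w : α → α → ℝ} (hw : ∀ u, ∑ v, w u v = 1)
    (s : α) : ∑ r, treeSum w r * w r s = treeSum w s := by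
  rw [sum_treeSum_mul, ← treeSum_mul_sum, hw, mul_one]

/-- Maximum principle: at a root `m` of maximal tree sum, stationarity and the column sum 1 make the
weighted sum of the deficits from the maximum vanish. The deficits are nonnegative and their weights
positive, so all are zero. -/
theorem treeSum_eq_of_pos {α : Type} [Fintype α] {w : α → α → ℝ} (hpos : ∀ u v, 0 < w u v)
    (hrow : ∀ u, ∑ v, w u v = 1) (hcol : ∀ v, ∑ u, w u v = 1) (r s : α) :
    treeSum w r = treeSum w s := by
  obtain ⟨m, -, hm⟩ := Finset.exists_max_image Finset.univ (treeSum w) ⟨r, Finset.mem_univ r⟩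
  have hsum : ∑ t, (treeSum w m - treeSum w t) * w t m = 0 := by
    simp only [sub_mul, Finset.sum_sub_distrib, ← Finset.mul_sum, hcol,
      sum_treeSum_mul_eq hrow]
    ring
  have hall : ∀ t, treeSum w t = treeSum w m := fun t => by
    have := (Finset.sum_eq_zero_iff_of_nonneg fun t _ =>
      mul_nonneg (sub_nonneg.mpr (hm t (Finset.mem_univ t))) (hpos t m).le).mp hsum t
        (Finset.mem_univ t)
    have := (mul_eq_zero.mp this).resolve_right (hpos t m).ne'
    linarith
  rw [hall r, hall s]

/-! ### Arborescences as functions -/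

/-- The edges of the tree directed toward `r` in which `f u` is the vertex after `u`. -/
def functionEdges {α : Type} [Fintype α] (r : α) (f : α → α) : Finset (α × α) :=
  (Finset.univ.erase r).image fun u => (u, f u)

theorem mem_functionEdges {α : Type} [Fintype α] {r : α} {f : α → α} {e : α × α} :
    e ∈ functionEdges r f ↔ e.1 ≠ r ∧ e.2 = f e.1 := by
  obtain ⟨a, b⟩ := e
  simp only [functionEdges, Finset.mem_image, Finset.mem_erase, Finset.mem_univ, and_true,
    Prod.mk.injEq]
  constructor
  · rintro ⟨u, hu, rfl, rfl⟩
    exact ⟨hu, rfl⟩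
  · rintro ⟨ha, hb⟩
    exact ⟨a, ha, rfl, hb.symm⟩

theorem prod_functionEdges {α : Type} [Fintype α] (r : α) (f : α → α) (w : α × α → ℝ) :
    ∏ e ∈ functionEdges r f, w e = ∏ u ∈ Finset.univ.erase r, w (u, f u) :=
  Finset.prod_image fun _ _ _ _ h => congrArg Prod.fst h

/-- The edge set does not record the value at `r`, so injectivity relies on the normalisation `f r =
r`. -/
theorem functionEdges_injOn {α : Type} [Fintype α] (r : α) :
    Set.InjOn (functionEdges r) {f : α → α | ReachedFromAll f r ∧ f r = r} := by
  rintro f ⟨-, hf⟩ g ⟨-, hg⟩ h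
  funext u
  by_cases hu : u = r
  · rw [hu, hf, hg]
  · have : (u, f u) ∈ functionEdges r g := h ▸ mem_functionEdges.mpr ⟨hu, rfl⟩
    exact (mem_functionEdges.mp this).2

/-- Every vertex other than `r` has one outgoing edge and `r` has none, so a walk ending at `r` is
forced at each step and must stop on its first arrival. -/
theorem isArborescence_functionEdges {n : ℕ} {r : Fin n} {f : Fin n → Fin n}
    (hf : ReachedFromAll f r) : IsArborescence r (functionEdges r f) := by
  have hex : ∀ (k : ℕ) (v : Fin n), f^[k] v = r → ∃ l : List (Fin n),
      List.IsChain (fun a b => (a, b) ∈ functionEdges r f) (v :: l) ∧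
        (v :: l).getLast (List.cons_ne_nil v l) = r := by
    intro k
    induction k with
    | zero => exact fun v hv => ⟨[], by simp, by simpa using hv⟩
    | succ k ih =>
      intro v hv
      by_cases hvr : v = r
      · exact ⟨[], by simp, by simpa using hvr⟩
      · obtain ⟨l, hl, hlast⟩ := ih (f v) hv
        exact ⟨f v :: l, List.isChain_cons_cons.mpr ⟨mem_functionEdges.mpr ⟨hvr, rfl⟩, hl⟩,
          by rwa [List.getLast_cons_cons]⟩
  have huniq : ∀ (l l' : List (Fin n)) (v : Fin n),
      List.IsChain (fun a b => (a, b) ∈ functionEdges r f) (v :: l) →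
      (v :: l).getLast (List.cons_ne_nil v l) = r →
      List.IsChain (fun a b => (a, b) ∈ functionEdges r f) (v :: l') →
      (v :: l').getLast (List.cons_ne_nil v l') = r → l = l' := by
    intro l
    induction l with
    | nil =>
      intro l' v _ hv hl' _
      cases l' with
      | nil => rfl
      | cons a l' =>
        exact absurd hv (mem_functionEdges.mp (List.isChain_cons_cons.mp hl').1).1
    | cons a l ih =>
      intro l' v hl hlast hl' hlast'
      have h₁ := List.isChain_cons_cons.mp hl
      have ha := mem_functionEdges.mp h₁.1
      cases l' with
      | nil => exact absurd hlast' ha.1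
      | cons b l' =>
        have h₂ := List.isChain_cons_cons.mp hl'
        have hb := mem_functionEdges.mp h₂.1
        simp only at ha hb
        obtain rfl : a = b := ha.2.trans hb.2.symm
        rw [List.getLast_cons_cons] at hlast hlast'
        rw [ih l' a h₁.2 hlast h₂.2 hlast']
  intro v
  obtain ⟨k, hk⟩ := hf v
  obtain ⟨l, hl, hlast⟩ := hex k v hk
  exact ⟨l, ⟨hl, hlast⟩, fun l' h => huniq l' l v h.1 h.2 hl hlast⟩

/-- Any edge out of `v` extends to a walk to `r`. Uniqueness of the walk from `v` therefore allows
only one such edge, and none if `v = r`, where the empty walk already ends at `r`. -/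
theorem IsArborescence.exists_functionEdges_eq {n : ℕ} {r : Fin n} {T : Finset (Fin n × Fin n)}
    (hT : IsArborescence r T) :
    ∃ f : Fin n → Fin n, (ReachedFromAll f r ∧ f r = r) ∧ functionEdges r f = T := by
  have hcons : ∀ {v u : Fin n} {l : List (Fin n)}, (v, u) ∈ T →
      List.IsChain (fun a b => (a, b) ∈ T) (u :: l) ∧
        (u :: l).getLast (List.cons_ne_nil u l) = r →
      List.IsChain (fun a b => (a, b) ∈ T) (v :: u :: l) ∧
        (v :: u :: l).getLast (List.cons_ne_nil v (u :: l)) = r := fun hvu hl =>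
    ⟨List.isChain_cons_cons.mpr ⟨hvu, hl.1⟩, by rw [List.getLast_cons_cons]; exact hl.2⟩
  have hout : ∀ v, v ≠ r → ∃ u, (v, u) ∈ T := by
    intro v hv
    obtain ⟨l, ⟨hl, hlast⟩, -⟩ := hT v
    cases l with
    | nil => exact absurd hlast hv
    | cons u l => exact ⟨u, (List.isChain_cons_cons.mp hl).1⟩
  have hdet : ∀ v u u', (v, u) ∈ T → (v, u') ∈ T → u = u' := by
    intro v u u' hu hu'
    obtain ⟨l, hl, -⟩ := hT u
    obtain ⟨l', hl', -⟩ := hT u'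
    have := (hT v).unique (hcons hu hl) (hcons hu' hl')
    exact (List.cons.inj this).1
  have hroot : ∀ u, (r, u) ∉ T := by
    intro u hu
    obtain ⟨l, hl, -⟩ := hT u
    have := (hT r).unique (hcons hu hl) (y₂ := []) ⟨by simp, by simp⟩
    exact List.cons_ne_nil _ _ this
  choose! g hg using hout
  have hf : ∀ v u, (v, u) ∈ T → Function.update g r r v = u := by
    intro v u hu
    have hv : v ≠ r := fun h => hroot u (h ▸ hu)
    rw [Function.update_of_ne hv]
    exact hdet v _ _ (hg v hv) hu
  refine ⟨Function.update g r r, ⟨?_, by simp⟩, ?_⟩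
  · have hwalk : ∀ (l : List (Fin n)) (v : Fin n),
        List.IsChain (fun a b => (a, b) ∈ T) (v :: l) →
        (v :: l).getLast (List.cons_ne_nil v l) = r →
        ∃ k, (Function.update g r r)^[k] v = r := by
      intro l
      induction l with
      | nil => exact fun v _ hv => ⟨0, hv⟩
      | cons u l ih =>
        intro v hl hlast
        rw [List.getLast_cons_cons] at hlast
        have h := List.isChain_cons_cons.mp hl
        obtain ⟨k, hk⟩ := ih u h.2 hlast
        exact ⟨k + 1, by rw [Function.iterate_succ_apply, hf v u h.1, hk]⟩
    intro v
    obtain ⟨l, ⟨hl, hlast⟩, -⟩ := hT v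
    exact hwalk l v hl hlast
  · ext ⟨v, u⟩
    rw [mem_functionEdges]
    constructor
    · rintro ⟨hv, hu⟩
      simp only at hv hu
      rw [hu, Function.update_of_ne hv]
      exact hg v hv
    · intro hu
      exact ⟨fun h => hroot u (h ▸ hu), (hf v u hu).symm⟩

theorem sum_arborescences {n : ℕ} (r : Fin n) (w : Fin n × Fin n → ℝ) :
    ∑ T ∈ arborescences r, ∏ e ∈ T, w e = treeSum (fun u v => w (u, v)) r := by
  symm
  refine Finset.sum_nbij (functionEdges r) ?_ ?_ ?_ ?_
  · intro f hf
    simp only [arborescences, Finset.mem_filter, Finset.mem_univ, true_and] at hf ⊢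
    exact isArborescence_functionEdges hf.1
  · simpa using functionEdges_injOn r
  · intro T hT
    simp only [arborescences, Finset.coe_filter, Finset.mem_univ, true_and,
      Set.mem_ofPred_eq] at hT
    obtain ⟨f, hf, rfl⟩ := hT.exists_functionEdges_eq
    exact ⟨f, by simpa using hf, rfl⟩
  · intro f _
    exact (prod_functionEdges r f w).symm

theorem matchingPoly_eq_treeSum {n : ℕ} (r : Fin n) (π : Equiv.Perm (Fin n))
    (x : Matrix (Fin n) (Fin n) ℝ) :
    matchingPoly r π x = (∏ i, x i (π i)) * treeSum (fun u v => x u (π v)) r := by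
  rw [matchingPoly, sum_arborescences r fun e => x e.1 (π e.2)]

/-! ### Reversing the cycle of a functional graph -/

/-- The permutation that agrees with `f` on the periodic points of `f` and fixes all others. -/
def cyclePerm {α : Type} [Finite α] (f : α → α) : Equiv.Perm α :=
  Equiv.ofBijective (fun u => if u ∈ Function.periodicPts f then f u else u) <| by
    refine Finite.injective_iff_bijective.mp fun u v h => ?_
    have hmaps := (Function.bijOn_periodicPts f).mapsTo
    by_cases hu : u ∈ Function.periodicPts f <;> by_cases hv : v ∈ Function.periodicPts f <;>
      simp only [hu, hv, if_true, if_false] at h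
    · exact (Function.bijOn_periodicPts f).injOn hu hv h
    · exact absurd (h ▸ hmaps hu) hv
    · exact absurd (h ▸ hmaps hv) hu
    · exact h

theorem cyclePerm_of_mem {α : Type} [Finite α] {f : α → α} {u : α}
    (hu : u ∈ Function.periodicPts f) : cyclePerm f u = f u := if_pos hu

theorem cyclePerm_of_notMem {α : Type} [Finite α] {f : α → α} {u : α}
    (hu : u ∉ Function.periodicPts f) : cyclePerm f u = u := if_neg hu

theorem cyclePerm_mem_iff {α : Type} [Finite α] (f : α → α) (u : α) :
    cyclePerm f u ∈ Function.periodicPts f ↔ u ∈ Function.periodicPts f := by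
  by_cases hu : u ∈ Function.periodicPts f
  · rw [cyclePerm_of_mem hu]
    exact iff_of_true ((Function.bijOn_periodicPts f).mapsTo hu) hu
  · rw [cyclePerm_of_notMem hu]

theorem cyclePerm_inv_mem_iff {α : Type} [Finite α] (f : α → α) (u : α) :
    (cyclePerm f)⁻¹ u ∈ Function.periodicPts f ↔ u ∈ Function.periodicPts f := by
  rw [← cyclePerm_mem_iff, Equiv.Perm.inv_def, Equiv.apply_symm_apply]

theorem cyclePerm_inv_of_notMem {α : Type} [Finite α] {f : α → α} {u : α}
    (hu : u ∉ Function.periodicPts f) : (cyclePerm f)⁻¹ u = u := by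
  rw [Equiv.Perm.inv_eq_iff_eq, cyclePerm_of_notMem hu]

/-- Reverse the direction of the cycles of `f`, and redirect the edges that enter a cycle to the
predecessor of their endpoint. -/
def reverseCycle {α : Type} [Finite α] (f : α → α) (u : α) : α :=
  (cyclePerm f)⁻¹ (if u ∈ Function.periodicPts f then u else f u)

theorem reverseCycle_of_mem {α : Type} [Finite α] {f : α → α} {u : α}
    (hu : u ∈ Function.periodicPts f) : reverseCycle f u = (cyclePerm f)⁻¹ u := by
  rw [reverseCycle, if_pos hu]

theorem reverseCycle_of_notMem {α : Type} [Finite α] {f : α → α} {u : α}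
    (hu : u ∉ Function.periodicPts f) : reverseCycle f u = (cyclePerm f)⁻¹ (f u) := by
  rw [reverseCycle, if_neg hu]

theorem iterate_reverseCycle {α : Type} [Finite α] {f : α → α} {u : α}
    (hu : u ∈ Function.periodicPts f) (k : ℕ) :
    (reverseCycle f)^[k] u = ((cyclePerm f)⁻¹ ^ k) u ∧
      (reverseCycle f)^[k] u ∈ Function.periodicPts f := by
  induction k with
  | zero => exact ⟨rfl, hu⟩
  | succ k ih =>
    rw [Function.iterate_succ_apply', reverseCycle_of_mem ih.2, ih.1, pow_succ',
      Equiv.Perm.mul_apply, cyclePerm_inv_mem_iff, ← ih.1]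
    exact ⟨rfl, ih.2⟩

theorem iterate_cyclePerm {α : Type} [Finite α] {f : α → α} {u : α}
    (hu : u ∈ Function.periodicPts f) (k : ℕ) :
    (cyclePerm f ^ k) u = f^[k] u ∧ (cyclePerm f ^ k) u ∈ Function.periodicPts f := by
  induction k with
  | zero => exact ⟨rfl, hu⟩
  | succ k ih =>
    rw [Function.iterate_succ_apply', pow_succ', Equiv.Perm.mul_apply, cyclePerm_mem_iff,
      cyclePerm_of_mem ih.2, ih.1]
    exact ⟨rfl, ih.1 ▸ ih.2⟩

/-- Away from the cycle, only edges entering it are redirected, and these still end on it. So the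
original path leads to the cycle as before. -/
theorem ReachedFromAll.exists_iterate_reverseCycle_mem {α : Type} [Finite α] {f : α → α} {r : α}
    (hf : ReachedFromAll f r) (v : α) :
    ∃ k, (reverseCycle f)^[k] v ∈ Function.periodicPts f := by
  obtain ⟨k, hk⟩ := hf v
  induction k generalizing v with
  | zero => exact ⟨0, (show v = r from hk) ▸ hf.mem_periodicPts⟩
  | succ k ih =>
    by_cases hv : v ∈ Function.periodicPts f
    · exact ⟨0, hv⟩
    by_cases hfv : f v ∈ Function.periodicPts f
    · refine ⟨1, ?_⟩
      rwa [Function.iterate_one, reverseCycle_of_notMem hv, cyclePerm_inv_mem_iff]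
    · obtain ⟨m, hm⟩ := ih (f v) hk
      refine ⟨m + 1, ?_⟩
      rwa [Function.iterate_succ_apply, reverseCycle_of_notMem hv, cyclePerm_inv_of_notMem hfv]

/-- Every orbit enters the cycle; there `f` leads to `r`, so the entry point and `r` share a cycle
of `cyclePerm f`, and going around it backwards reaches `r` too. -/
theorem ReachedFromAll.reverseCycle {α : Type} [Finite α] {f : α → α} {r : α}
    (hf : ReachedFromAll f r) : ReachedFromAll (reverseCycle f) r := fun v => by
  obtain ⟨k, hk⟩ := hf.exists_iterate_reverseCycle_mem v
  obtain ⟨m, hm⟩ := hf ((MatchingFactory.reverseCycle f)^[k] v)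
  rw [← (iterate_cyclePerm hk m).1] at hm
  have hsame : (cyclePerm f)⁻¹.SameCycle ((MatchingFactory.reverseCycle f)^[k] v) r :=
    Equiv.Perm.sameCycle_inv.mpr ⟨m, by simpa using hm⟩
  obtain ⟨l, hl⟩ := hsame.exists_nat_pow_eq
  refine ⟨l + k, ?_⟩
  rw [Function.iterate_add_apply, (iterate_reverseCycle hk l).1, hl]

theorem ReachedFromAll.periodicPts_reverseCycle {α : Type} [Finite α] {f : α → α} {r : α}
    (hf : ReachedFromAll f r) :
    Function.periodicPts (MatchingFactory.reverseCycle f) = Function.periodicPts f := by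
  ext u
  constructor
  · rintro ⟨p, hp, hu⟩
    obtain ⟨k, hk⟩ := hf.exists_iterate_reverseCycle_mem u
    -- The orbit of `u` is on the cycle after `k` steps and stays there; after `p * k` steps, a
    -- multiple of the period, it is back at `u`.
    have hle : k ≤ p * k := Nat.le_mul_of_pos_left k hp
    have h := (iterate_reverseCycle hk (p * k - k)).2
    rw [← Function.iterate_add_apply, Nat.sub_add_cancel hle, (hu.mul_const k).eq] at h
    exact h
  · intro hu
    refine ⟨orderOf (cyclePerm f)⁻¹, orderOf_pos _, ?_⟩
    rw [Function.IsPeriodicPt, Function.IsFixedPt, (iterate_reverseCycle hu _).1,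
      pow_orderOf_eq_one, Equiv.Perm.one_apply]

theorem ReachedFromAll.cyclePerm_reverseCycle {α : Type} [Finite α] {f : α → α} {r : α}
    (hf : ReachedFromAll f r) :
    cyclePerm (MatchingFactory.reverseCycle f) = (cyclePerm f)⁻¹ := by
  ext u
  by_cases hu : u ∈ Function.periodicPts f
  · rw [cyclePerm_of_mem (hf.periodicPts_reverseCycle ▸ hu), reverseCycle_of_mem hu]
  · rw [cyclePerm_of_notMem (hf.periodicPts_reverseCycle ▸ hu), cyclePerm_inv_of_notMem hu]

theorem ReachedFromAll.reverseCycle_reverseCycle {α : Type} [Finite α] {f : α → α} {r : α}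
    (hf : ReachedFromAll f r) :
    MatchingFactory.reverseCycle (MatchingFactory.reverseCycle f) = f := by
  funext u
  rw [MatchingFactory.reverseCycle, hf.cyclePerm_reverseCycle, hf.periodicPts_reverseCycle,
    inv_inv]
  split_ifs with hu
  · exact cyclePerm_of_mem hu
  · rw [reverseCycle_of_notMem hu, Equiv.Perm.inv_def, Equiv.apply_symm_apply]

theorem apply_cyclePerm_reverseCycle {α : Type} [Finite α] (f : α → α) (u : α) :
    cyclePerm f (reverseCycle f u) = if u ∈ Function.periodicPts f then u else f u := by
  rw [reverseCycle, Equiv.Perm.inv_def, Equiv.apply_symm_apply]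

/-- The heart of the argument: a weight-preserving involution on pairs. With `c = cyclePerm f` and
`i` on the cycle, `(π * c) i = π (f i)` and `(π * c) (reverseCycle f i) = π i`, so the two side
conditions are exchanged. -/
theorem sum_swap_reverseCycle {α : Type} [Fintype α] (x : α → α → ℝ) (i j : α) :
    ∑ p : Equiv.Perm α × (α → α) with ReachedFromAll p.2 i ∧ p.1 (p.2 i) = j,
        (∏ u, x u (p.1 u)) * ∏ u, x u (p.1 (p.2 u)) =
      ∑ p : Equiv.Perm α × (α → α) with ReachedFromAll p.2 i ∧ p.1 i = j,
        (∏ u, x u (p.1 u)) * ∏ u, x u (p.1 (p.2 u)) := by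
  refine Finset.sum_nbij' (fun p => (p.1 * cyclePerm p.2, reverseCycle p.2))
    (fun p => (p.1 * cyclePerm p.2, reverseCycle p.2)) ?_ ?_ ?_ ?_ ?_
  · rintro ⟨π, f⟩ h
    simp only [Finset.mem_filter, Finset.mem_univ, true_and, Equiv.Perm.mul_apply] at h ⊢
    exact ⟨h.1.reverseCycle, by rw [cyclePerm_of_mem h.1.mem_periodicPts, h.2]⟩
  · rintro ⟨π, f⟩ h
    simp only [Finset.mem_filter, Finset.mem_univ, true_and, Equiv.Perm.mul_apply] at h ⊢
    exact ⟨h.1.reverseCycle, by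
      rw [apply_cyclePerm_reverseCycle, if_pos h.1.mem_periodicPts, h.2]⟩
  · rintro ⟨π, f⟩ h
    simp only [Finset.mem_filter, Finset.mem_univ, true_and] at h
    simp only [h.1.cyclePerm_reverseCycle, h.1.reverseCycle_reverseCycle, mul_inv_cancel_right]
  · rintro ⟨π, f⟩ h
    simp only [Finset.mem_filter, Finset.mem_univ, true_and] at h
    simp only [h.1.cyclePerm_reverseCycle, h.1.reverseCycle_reverseCycle, mul_inv_cancel_right]
  · rintro ⟨π, f⟩ -
    simp only [Equiv.Perm.mul_apply, apply_cyclePerm_reverseCycle, ← Finset.prod_mul_distrib]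
    refine Finset.prod_congr rfl fun u _ => ?_
    -- On the cycle the factors `x u (π u)` and `x u (π (f u))` trade places; off the cycle each one
    -- is unchanged.
    by_cases hu : u ∈ Function.periodicPts f
    · rw [cyclePerm_of_mem hu, if_pos hu, mul_comm]
    · rw [cyclePerm_of_notMem hu, if_neg hu]

/-! ### The vector equality -/

/-- Rooting at the row index `i` makes `x i j` the weight of an edge out of the root, and only the
row sums are needed. Both sides become sums over pairs `(π, f)` matched by `sum_swap_reverseCycle`.
-/
theorem mul_sum_matchingPoly_root {n : ℕ} {x : Matrix (Fin n) (Fin n) ℝ}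
    (hrow : ∀ u, ∑ v, x u v = 1) (i j : Fin n) :
    x i j * ∑ π : Equiv.Perm (Fin n), matchingPoly i π x =
      ∑ π : Equiv.Perm (Fin n) with π i = j, matchingPoly i π x := by
  have hl : ∀ π : Equiv.Perm (Fin n), x i j * matchingPoly i π x =
      ∑ f : Fin n → Fin n with ReachedFromAll f i ∧ π (f i) = j,
        (∏ u, x u (π u)) * ∏ u, x u (π (f u)) := fun π => by
    have h : treeSum (fun u v => x u (π v)) i * x i j =
        ∑ f : Fin n → Fin n with ReachedFromAll f i ∧ π (f i) = j, ∏ u, x u (π (f u)) := by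
      -- The edge from `i` to `π⁻¹ j` is the one of weight `x i j`.
      have := treeSum_mul (fun u v => x u (π v)) i (π.symm j)
      simp only [Equiv.apply_symm_apply, Equiv.eq_symm_apply] at this
      convert this
    rw [matchingPoly_eq_treeSum, ← Finset.mul_sum, ← h]
    ring
  have hr : ∀ π : Equiv.Perm (Fin n), matchingPoly i π x =
      ∑ f : Fin n → Fin n with ReachedFromAll f i,
        (∏ u, x u (π u)) * ∏ u, x u (π (f u)) := fun π => by
    have h : treeSum (fun u v => x u (π v)) i =
        ∑ f : Fin n → Fin n with ReachedFromAll f i, ∏ u, x u (π (f u)) := by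
      have := treeSum_mul_sum (fun u v => x u (π v)) i
      rw [Equiv.sum_comp π (x i), hrow, mul_one] at this
      convert this
    rw [matchingPoly_eq_treeSum, ← Finset.mul_sum, ← h]
  rw [Finset.mul_sum, Finset.sum_congr rfl fun π _ => hl π,
    Finset.sum_congr rfl fun π _ => hr π]
  have h : ∑ π : Equiv.Perm (Fin n), ∑ f : Fin n → Fin n,
        (if ReachedFromAll f i ∧ π (f i) = j then
          (∏ u, x u (π u)) * ∏ u, x u (π (f u)) else 0) =
      ∑ π : Equiv.Perm (Fin n), ∑ f : Fin n → Fin n,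
        (if ReachedFromAll f i ∧ π i = j then
          (∏ u, x u (π u)) * ∏ u, x u (π (f u)) else 0) := by
    have := sum_swap_reverseCycle x i j
    simp only [Finset.sum_filter, Fintype.sum_prod_type] at this
    convert this
  simp only [Finset.sum_filter]
  rw [h]
  refine Finset.sum_congr rfl fun π _ => ?_
  split_ifs with hπ
  · exact Finset.sum_congr rfl fun f _ => by simp [hπ]
  · exact Finset.sum_eq_zero fun f _ => if_neg fun hf => hπ hf.2

/-- Permuting the columns of `x` by `π` keeps it doubly stochastic, so its tree sums do not depend
on the root. -/
theorem matchingPoly_root_eq {n : ℕ} {x : Matrix (Fin n) (Fin n) ℝ}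
    (hx : x ∈ doublyStochastic ℝ (Fin n)) (hpos : ∀ i j, 0 < x i j) (r s : Fin n)
    (π : Equiv.Perm (Fin n)) : matchingPoly r π x = matchingPoly s π x := by
  rw [matchingPoly_eq_treeSum, matchingPoly_eq_treeSum]
  congr 1
  refine treeSum_eq_of_pos (fun u v => hpos u (π v)) (fun u => ?_) (fun v => ?_) r s
  · rw [Equiv.sum_comp π (x u), sum_row_of_mem_doublyStochastic hx]
  · exact sum_col_of_mem_doublyStochastic hx (π v)

theorem continuous_matchingPoly {n : ℕ} (r : Fin n) (π : Equiv.Perm (Fin n)) :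
    Continuous (matchingPoly r π) := by
  unfold matchingPoly
  fun_prop

/-- Every doubly stochastic matrix is the limit at `0` of the segment toward the barycenter, along
which all entries are positive. -/
theorem eqOn_doublyStochastic_of_pos {n : ℕ} {F : Matrix (Fin n) (Fin n) ℝ → ℝ}
    (hF : Continuous F)
    (h : ∀ x ∈ doublyStochastic ℝ (Fin n), (∀ i j, 0 < x i j) → F x = 0)
    {x : Matrix (Fin n) (Fin n) ℝ} (hx : x ∈ doublyStochastic ℝ (Fin n)) : F x = 0 := by
  -- The barycenter with entries `1 / n` exists only for `n > 0`; for `n = 0` positivity is vacuous.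
  rcases Nat.eq_zero_or_pos n with rfl | hn
  · exact h x hx fun i => i.elim0
  have hn' : (0 : ℝ) < n := by exact_mod_cast hn
  let J : Matrix (Fin n) (Fin n) ℝ := fun _ _ => 1 / n
  have hJ : J ∈ doublyStochastic ℝ (Fin n) := by
    rw [mem_doublyStochastic_iff_sum]
    refine ⟨fun i j => by positivity, fun i => ?_, fun j => ?_⟩ <;>
    · simp only [J, Finset.sum_const, Finset.card_univ, Fintype.card_fin, nsmul_eq_mul]
      field_simp
  have hcont : Continuous fun t : ℝ => F ((1 - t) • x + t • J) := by fun_prop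
  have hlim : Filter.Tendsto (fun t : ℝ => F ((1 - t) • x + t • J)) (nhdsWithin 0 (Set.Ioi 0))
      (nhds (F x)) := by
    have := (hcont.tendsto 0).mono_left (nhdsWithin_le_nhds (s := Set.Ioi 0))
    simpa using this
  refine tendsto_nhds_unique hlim (tendsto_const_nhds.congr' ?_)
  filter_upwards [Ioo_mem_nhdsGT (zero_lt_one' ℝ)] with t ht
  refine (h _ (convex_doublyStochastic hx hJ (by linarith [ht.2]) ht.1.le (by ring))
    fun i j => ?_).symm
  have h₁ : 0 ≤ (1 - t) * x i j :=
    mul_nonneg (by linarith [ht.2]) (nonneg_of_mem_doublyStochastic hx)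
  have h₂ : 0 < t * (1 / (n : ℝ)) := mul_pos ht.1 (by positivity)
  exact add_pos_of_nonneg_of_pos h₁ h₂

/-- For positive matrices the root may be moved to `i`, a different root for each row; continuity
removes positivity. -/
theorem mul_sum_matchingPoly {n : ℕ} (r : Fin n) {x : Matrix (Fin n) (Fin n) ℝ}
    (hx : x ∈ doublyStochastic ℝ (Fin n)) (i j : Fin n) :
    x i j * ∑ π : Equiv.Perm (Fin n), matchingPoly r π x =
      ∑ π : Equiv.Perm (Fin n) with π i = j, matchingPoly r π x := by
  rw [← sub_eq_zero]
  have hc := continuous_matchingPoly r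
  refine eqOn_doublyStochastic_of_pos
    (F := fun x => x i j * ∑ π : Equiv.Perm (Fin n), matchingPoly r π x -
      ∑ π : Equiv.Perm (Fin n) with π i = j, matchingPoly r π x) (by fun_prop) ?_ hx
  intro y hy hpos
  simp only [matchingPoly_root_eq hy hpos r i]
  rw [sub_eq_zero]
  exact mul_sum_matchingPoly_root (sum_row_of_mem_doublyStochastic hy) i j

theorem sum_matchingPoly_smul_permMatrix {n : ℕ} (r : Fin n) {x : Matrix (Fin n) (Fin n) ℝ}
    (hx : x ∈ doublyStochastic ℝ (Fin n)) :
    ∑ π : Equiv.Perm (Fin n), matchingPoly r π x • π.permMatrix ℝ =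
      (∑ π : Equiv.Perm (Fin n), matchingPoly r π x) • x := by
  ext i j
  rw [Matrix.sum_apply, Matrix.smul_apply, smul_eq_mul, mul_comm, mul_sum_matchingPoly r hx,
    Finset.sum_filter]
  refine Finset.sum_congr rfl fun π _ => ?_
  simp [Equiv.Perm.permMatrix, PEquiv.toMatrix_apply, eq_comm]

theorem sum_matchingPoly_smul_sub {n : ℕ} (r : Fin n) {x : Matrix (Fin n) (Fin n) ℝ}
    (hx : x ∈ doublyStochastic ℝ (Fin n)) :
    ∑ π : Equiv.Perm (Fin n), matchingPoly r π x • (π.permMatrix ℝ - x) = 0 := by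
  simp only [smul_sub, Finset.sum_sub_distrib, sum_matchingPoly_smul_permMatrix r hx,
    Finset.sum_smul, sub_self]

theorem matchingPoly_pos {n : ℕ} (r : Fin n) {x : Matrix (Fin n) (Fin n) ℝ}
    (hpos : ∀ i j, 0 < x i j) (π : Equiv.Perm (Fin n)) : 0 < matchingPoly r π x := by
  rw [matchingPoly_eq_treeSum]
  refine mul_pos (Finset.prod_pos fun i _ => hpos _ _) ?_
  -- The star, in which every vertex points to `r`, shows that there is at least one tree.
  refine Finset.sum_pos (fun f _ => Finset.prod_pos fun u _ => hpos _ _) ⟨fun _ => r, ?_⟩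
  simpa using (show ReachedFromAll (fun _ : Fin n => r) r from fun _ => ⟨1, rfl⟩)

/-! ### Spanning trees oriented toward the root -/

theorem mem_orientToward {n : ℕ} {r : Fin n} {G : SimpleGraph (Fin n)} {e : Fin n × Fin n} :
    e ∈ orientToward r G ↔ G.Adj e.1 e.2 ∧ G.dist e.2 r < G.dist e.1 r := by
  simp [orientToward]

theorem exists_adj_dist_succ {V : Type} {G : SimpleGraph V} (hG : G.Connected) {v r : V}
    (hv : v ≠ r) : ∃ w, G.Adj v w ∧ G.dist w r + 1 = G.dist v r := by
  obtain ⟨p, hp⟩ := hG.exists_walk_length_eq_dist v r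
  cases p with
  | nil => exact absurd rfl hv
  | @cons _ w _ h q =>
    refine ⟨w, h, ?_⟩
    rw [SimpleGraph.Walk.length_cons] at hp
    have h₁ := G.dist_le q
    obtain ⟨q', hq'⟩ := hG.exists_walk_length_eq_dist w r
    have h₂ := G.dist_le (SimpleGraph.Walk.cons h q')
    rw [SimpleGraph.Walk.length_cons] at h₂
    omega

/-- Each of the two neighbours starts a shortest walk from `v` to `r`; shortest walks are paths, and
a tree has only one path from `v` to `r`. -/
theorem eq_of_adj_of_dist_succ {V : Type} {G : SimpleGraph V} (hG : G.IsTree) {v w w' r : V}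
    (hw : G.Adj v w) (hd : G.dist w r + 1 = G.dist v r)
    (hw' : G.Adj v w') (hd' : G.dist w' r + 1 = G.dist v r) : w = w' := by
  obtain ⟨q, hq⟩ := hG.connected.exists_walk_length_eq_dist w r
  obtain ⟨q', hq'⟩ := hG.connected.exists_walk_length_eq_dist w' r
  have hp := (SimpleGraph.Walk.cons hw q).isPath_of_length_eq_dist (by simp [hq, hd])
  have hp' := (SimpleGraph.Walk.cons hw' q').isPath_of_length_eq_dist (by simp [hq', hd'])
  have := (hG.isAcyclic.subsingleton_path v r).elim ⟨_, hp⟩ ⟨_, hp'⟩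
  simpa using congrArg (fun p : G.Path v r => (p : G.Walk v r).snd) this

/-- Let `f` send each vertex to its neighbour nearer to `r`. The distance drops by one at each step,
so `r` is reached, and the oriented edges are exactly those of `f`. -/
theorem isArborescence_orientToward {n : ℕ} {r : Fin n} {G : SimpleGraph (Fin n)}
    (hG : G.IsTree) : IsArborescence r (orientToward r G) := by
  have hex : ∀ v, v ≠ r → ∃ w, G.Adj v w ∧ G.dist w r + 1 = G.dist v r :=
    fun v hv => exists_adj_dist_succ hG.connected hv
  choose! f hf using hex
  have hreach : ReachedFromAll f r := by
    have : ∀ (d : ℕ) (v : Fin n), G.dist v r = d → ∃ k, f^[k] v = r := by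
      intro d
      induction d with
      | zero => exact fun v hv => ⟨0, hG.connected.dist_eq_zero_iff.mp hv⟩
      | succ d ih =>
        intro v hv
        have hvr : v ≠ r := by
          rintro rfl
          simp at hv
        obtain ⟨k, hk⟩ := ih (f v) (by have := (hf v hvr).2; omega)
        exact ⟨k + 1, hk⟩
    exact fun v => this _ v rfl
  have heq : orientToward r G = functionEdges r f := by
    ext ⟨a, b⟩
    rw [mem_orientToward, mem_functionEdges]
    constructor
    · rintro ⟨hab, hlt⟩
      simp only at hab hlt ⊢
      have ha : a ≠ r := by
        rintro rfl
        simp at hlt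
      refine ⟨ha, eq_of_adj_of_dist_succ hG hab ?_ (hf a ha).1 (hf a ha).2⟩
      have := hG.dist_eq_dist_add_one_of_adj r hab
      rw [G.dist_comm (u := r), G.dist_comm (u := r)] at this
      omega
    · rintro ⟨ha, hb⟩
      simp only at ha hb
      subst hb
      exact ⟨(hf a ha).1, by have := (hf a ha).2; simp only; omega⟩
  rw [heq]
  exact isArborescence_functionEdges hreach

/-- Adjacent vertices of a tree are never equidistant from `r`, so orientation loses no edge. This
makes `orientToward r` injective on trees. -/
theorem adj_iff_mem_orientToward {n : ℕ} (r : Fin n) {G : SimpleGraph (Fin n)} (hG : G.IsTree)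
    (a b : Fin n) : G.Adj a b ↔ (a, b) ∈ orientToward r G ∨ (b, a) ∈ orientToward r G := by
  simp only [mem_orientToward]
  constructor
  · intro h
    have := hG.dist_ne_of_adj r h
    rw [G.dist_comm (u := r), G.dist_comm (u := r)] at this
    rcases this.lt_or_gt with hlt | hlt
    · exact Or.inr ⟨h.symm, hlt⟩
    · exact Or.inl ⟨h, hlt⟩
  · rintro (h | h)
    exacts [h.1, h.1.symm]

/-- The undirected graph in which every vertex `u ≠ r` is joined to `f u`. -/
def functionGraph {α : Type} (r : α) (f : α → α) : SimpleGraph α :=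
  SimpleGraph.fromRel fun a b => a ≠ r ∧ b = f a

/-- The number of steps after which iterating `f` leads to `r`. -/
def ReachedFromAll.height {α : Type} {f : α → α} {r : α} (hf : ReachedFromAll f r) (v : α) : ℕ :=
  Nat.find (hf v)

theorem ReachedFromAll.height_root {α : Type} {f : α → α} {r : α} (hf : ReachedFromAll f r) :
    hf.height r = 0 := (Nat.find_eq_zero _).mpr rfl

theorem ReachedFromAll.height_eq_succ {α : Type} {f : α → α} {r : α} (hf : ReachedFromAll f r)
    {v : α} (hv : v ≠ r) : hf.height v = hf.height (f v) + 1 := by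
  refine le_antisymm (Nat.find_min' _ (Nat.find_spec (hf (f v)))) ?_
  have hspec : f^[hf.height v] v = r := Nat.find_spec (hf v)
  obtain ⟨k, hk⟩ : ∃ k, hf.height v = k + 1 := Nat.exists_eq_succ_of_ne_zero fun h0 => by
    rw [h0] at hspec
    exact hv hspec
  rw [hk, Function.iterate_succ_apply] at hspec
  have : hf.height (f v) ≤ k := Nat.find_min' _ hspec
  omega

theorem ReachedFromAll.apply_ne {α : Type} {f : α → α} {r : α} (hf : ReachedFromAll f r)
    {v : α} (hv : v ≠ r) : f v ≠ v := fun h => by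
  have := hf.height_eq_succ hv
  rw [h] at this
  omega

theorem ReachedFromAll.functionGraph_adj {α : Type} {f : α → α} {r : α}
    (hf : ReachedFromAll f r) {a b : α} :
    (functionGraph r f).Adj a b ↔ (a ≠ r ∧ b = f a) ∨ (b ≠ r ∧ a = f b) := by
  rw [functionGraph, SimpleGraph.fromRel_adj, and_iff_right_iff_imp]
  rintro (⟨ha, rfl⟩ | ⟨hb, rfl⟩)
  exacts [(hf.apply_ne ha).symm, hf.apply_ne hb]

theorem ReachedFromAll.exists_walk {α : Type} {f : α → α} {r : α} (hf : ReachedFromAll f r)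
    (v : α) : ∃ p : (functionGraph r f).Walk v r, p.length = hf.height v := by
  induction h : hf.height v generalizing v with
  | zero =>
    have hspec : f^[hf.height v] v = r := Nat.find_spec (hf v)
    rw [h] at hspec
    obtain rfl : v = r := hspec
    exact ⟨.nil, rfl⟩
  | succ k ih =>
    have hv : v ≠ r := by
      rintro rfl
      rw [hf.height_root] at h
      omega
    obtain ⟨p, hp⟩ := ih (f v) (by have := hf.height_eq_succ hv; omega)
    exact ⟨.cons (hf.functionGraph_adj.mpr (Or.inl ⟨hv, rfl⟩)) p, by simp [hp]⟩

/-- The height changes by exactly one along each edge, so no walk to `r` is shorter than the one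
that follows `f`; hence height is distance to `r`. -/
theorem ReachedFromAll.height_le_length_add {α : Type} {f : α → α} {r : α}
    (hf : ReachedFromAll f r) {v w : α} (p : (functionGraph r f).Walk v w) :
    hf.height v ≤ p.length + hf.height w := by
  induction p with
  | nil => simp
  | cons h p ih =>
    rw [SimpleGraph.Walk.length_cons]
    rcases hf.functionGraph_adj.mp h with ⟨ha, rfl⟩ | ⟨hb, rfl⟩
    · have := hf.height_eq_succ ha
      omega
    · have := hf.height_eq_succ hb
      omega

theorem ReachedFromAll.functionGraph_connected {α : Type} {f : α → α} {r : α}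
    (hf : ReachedFromAll f r) : (functionGraph r f).Connected := by
  have : Nonempty α := ⟨r⟩
  refine ⟨fun u v => ?_⟩
  obtain ⟨p, -⟩ := hf.exists_walk u
  obtain ⟨q, -⟩ := hf.exists_walk v
  exact p.reachable.trans q.reachable.symm

theorem ReachedFromAll.functionGraph_dist {α : Type} {f : α → α} {r : α}
    (hf : ReachedFromAll f r) (v : α) : (functionGraph r f).dist v r = hf.height v := by
  obtain ⟨p, hp⟩ := hf.exists_walk v
  obtain ⟨q, hq⟩ := hf.functionGraph_connected.exists_walk_length_eq_dist v r
  refine le_antisymm (hp ▸ SimpleGraph.dist_le p) ?_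
  simpa [hq, hf.height_root] using hf.height_le_length_add q

/-- The graph is connected, and it has at most one edge for each vertex other than `r`, the fewest a
connected graph can have. -/
theorem ReachedFromAll.functionGraph_isTree {α : Type} [Fintype α] {f : α → α} {r : α}
    (hf : ReachedFromAll f r) : (functionGraph r f).IsTree := by
  have hconn := hf.functionGraph_connected
  refine SimpleGraph.isTree_iff_connected_and_card.mpr
    ⟨hconn, le_antisymm ?_ hconn.card_vert_le_card_edgeSet_add_one⟩
  have hsub : (functionGraph r f).edgeSet ⊆
      ((Finset.univ.erase r).image fun u => s(u, f u) : Finset (Sym2 α)) := by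
    intro e
    induction e with
    | h a b =>
      rw [SimpleGraph.mem_edgeSet, hf.functionGraph_adj]
      rintro (⟨ha, rfl⟩ | ⟨hb, rfl⟩)
      · exact Finset.mem_coe.mpr (Finset.mem_image.mpr ⟨a, by simp [ha], rfl⟩)
      · exact Finset.mem_coe.mpr (Finset.mem_image.mpr ⟨b, by simp [hb], Sym2.eq_swap⟩)
  have h₁ := Set.ncard_le_ncard hsub (Finset.finite_toSet _)
  rw [Set.ncard_coe_finset] at h₁
  have h₂ := h₁.trans Finset.card_image_le
  have h₃ := Finset.card_erase_add_one (Finset.mem_univ r)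
  rw [Finset.card_univ, ← Nat.card_eq_fintype_card] at h₃
  rw [Nat.card_coe_set_eq]
  omega

theorem orientToward_functionGraph {n : ℕ} {r : Fin n} {f : Fin n → Fin n}
    (hf : ReachedFromAll f r) : orientToward r (functionGraph r f) = functionEdges r f := by
  ext ⟨a, b⟩
  rw [mem_orientToward, mem_functionEdges, hf.functionGraph_adj, hf.functionGraph_dist,
    hf.functionGraph_dist]
  constructor
  · rintro ⟨h | ⟨hb, ha⟩, hlt⟩
    · exact h
    · simp only at hb ha hlt
      have := hf.height_eq_succ hb
      rw [← ha] at this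
      omega
  · rintro ⟨ha, hb⟩
    simp only at ha hb
    subst hb
    have := hf.height_eq_succ ha
    exact ⟨Or.inl ⟨ha, rfl⟩, by simp only; omega⟩

/-- Orienting the edges toward `r` is a bijection from spanning trees to arborescences. -/
theorem sum_spanningTrees {n : ℕ} (r : Fin n) (F : Finset (Fin n × Fin n) → ℝ) :
    ∑ G ∈ spanningTrees n, F (orientToward r G) = ∑ T ∈ arborescences r, F T := by
  refine Finset.sum_nbij (orientToward r) ?_ ?_ ?_ fun _ _ => rfl
  · intro G hG
    simp only [spanningTrees, arborescences, Finset.mem_filter, Finset.mem_univ, true_and]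
      at hG ⊢
    exact isArborescence_orientToward hG
  · intro G hG H hH h
    simp only [spanningTrees, Finset.coe_filter, Finset.mem_univ, true_and,
      Set.mem_ofPred_eq] at hG hH
    ext a b
    rw [adj_iff_mem_orientToward r hG, adj_iff_mem_orientToward r hH, h]
  · intro T hT
    simp only [arborescences, Finset.coe_filter, Finset.mem_univ, true_and,
      Set.mem_ofPred_eq] at hT
    obtain ⟨f, ⟨hf, -⟩, rfl⟩ := hT.exists_functionEdges_eq
    exact ⟨functionGraph r f, by simpa [spanningTrees] using hf.functionGraph_isTree,
      orientToward_functionGraph hf⟩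

/-! ### The factory for perfect matchings -/

/-- The uniform choice of a spanning tree turns the sum over arborescences into an average. The
resulting factor does not depend on `π`, so it cancels in the race. -/
theorem outProb_matchingTrial {n : ℕ} (r : Fin n) (π : Equiv.Perm (Fin n))
    (x : Matrix (Fin n) (Fin n) ℝ) :
    (matchingTrial r π).outProb (fun e => x e.1 e.2) true =
      1 / ((spanningTrees n).card : ℝ) * matchingPoly r π x := by
  have hbind : ((FinTree.uniform (spanningTrees n) (spanningTrees_nonempty r)).bind fun G =>
      FinTree.allOnes ((orientToward r G).toList.map fun e => (e.1, π e.2)) :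
        FinTree (Fin n × Fin n) Bool).outProb (fun e => x e.1 e.2) true =
      1 / ((spanningTrees n).card : ℝ) * ∑ T ∈ arborescences r, ∏ e ∈ T, x e.1 (π e.2) := by
    rw [FinTree.outProb_bind, ← sum_spanningTrees r fun T => ∏ e ∈ T, x e.1 (π e.2),
      Finset.mul_sum, ← Finset.sum_subset (Finset.subset_univ (spanningTrees n))]
    · refine Finset.sum_congr rfl fun G hG => ?_
      rw [FinTree.outProb_uniform, if_pos hG, FinTree.outProb_allOnes, List.map_map]
      exact congrArg _ (Finset.prod_map_toList (orientToward r G) _)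
    · intro G _ hG
      rw [FinTree.outProb_uniform, if_neg hG, zero_mul]
  rw [matchingTrial, FinTree.outProb_bind, Fintype.sum_bool, if_pos rfl, hbind,
    FinTree.outProb_allOnes, List.map_map, matchingPoly]
  simp only [Bool.false_eq_true, if_false, FinTree.outProb, mul_zero, add_zero]
  rw [Fin.prod_univ_def, Function.comp_def]
  ring

theorem prob_matchingFactory {n : ℕ} (r : Fin n) {x : Matrix (Fin n) (Fin n) ℝ}
    (hx : x ∈ doublyStochastic ℝ (Fin n))
    (hpos : 0 < ∑ σ : Equiv.Perm (Fin n), matchingPoly r σ x) (π : Equiv.Perm (Fin n)) :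
    (matchingFactory r).prob (fun e => x e.1 e.2) π =
      matchingPoly r π x / ∑ σ : Equiv.Perm (Fin n), matchingPoly r σ x := by
  have hN : (0 : ℝ) < 1 / ((spanningTrees n).card : ℝ) := by
    have := Finset.card_pos.mpr (spanningTrees_nonempty r)
    positivity
  rw [matchingFactory, prob_race]
  · simp only [outProb_matchingTrial, ← Finset.mul_sum]
    rw [mul_div_mul_left _ _ hN.ne']
  · exact fun e => ⟨nonneg_of_mem_doublyStochastic hx, le_one_of_mem_doublyStochastic hx⟩
  · simp only [outProb_matchingTrial, ← Finset.mul_sum]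
    exact mul_pos hN hpos

theorem sum_matchingPoly_pos {n : ℕ} (r : Fin n) {x : Matrix (Fin n) (Fin n) ℝ}
    (hpos : ∀ i j, 0 < x i j) : 0 < ∑ σ : Equiv.Perm (Fin n), matchingPoly r σ x :=
  Finset.sum_pos (fun σ _ => matchingPoly_pos r hpos σ) Finset.univ_nonempty

theorem permMatrix_injective {n : ℕ} :
    Function.Injective fun π : Equiv.Perm (Fin n) => π.permMatrix ℝ := by
  intro π σ h
  ext1 i
  have := congrFun (congrFun h i) (π i)
  by_contra hne
  simp [Equiv.Perm.permMatrix, PEquiv.toMatrix_apply, Ne.symm hne] at this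

theorem isBernoulliFactoryFor_matchingFactory {n : ℕ} (r : Fin n) :
    IsBernoulliFactoryFor (doublyStochastic ℝ (Fin n) : Set (Matrix (Fin n) (Fin n) ℝ))
      (fun π : Equiv.Perm (Fin n) => π.permMatrix ℝ) (matchingFactory r) where
  vert_injective := permMatrix_injective
  range_vert := by
    -- Birkhoff's theorem: the extreme points are the permutation matrices.
    rw [extremePoints_doublyStochastic]
    rfl
  terminates x hx h := by
    have hpos := sum_matchingPoly_pos r fun i j => (h i j).1
    rw [Factory.TerminatesAt]
    simp only [prob_matchingFactory r hx hpos, ← Finset.sum_div]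
    exact div_self hpos.ne'
  expectation x hx h := by
    have hpos := sum_matchingPoly_pos r fun i j => (h i j).1
    simp only [prob_matchingFactory r hx hpos, div_eq_inv_mul, mul_smul, ← Finset.smul_sum]
    rw [sum_matchingPoly_smul_permMatrix r hx, smul_smul, inv_mul_cancel₀ hpos.ne', one_smul]

end MatchingFactory

end

theorem proposition3p3 (n : ℕ) (r : Fin n) :
    -- the vector equality, on the whole Birkhoff polytope
    (∀ x ∈ doublyStochastic ℝ (Fin n),
      ∑ π : Equiv.Perm (Fin n),
        MatchingFactory.matchingPoly r π x • (π.permMatrix ℝ - x) = 0) ∧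
    -- the factory outputs every permutation with probability proportional to its weight
    (∀ x ∈ doublyStochastic ℝ (Fin n),
      0 < ∑ σ : Equiv.Perm (Fin n), MatchingFactory.matchingPoly r σ x →
      ∀ π : Equiv.Perm (Fin n),
        (MatchingFactory.matchingFactory r).prob (fun e => x e.1 e.2) π =
          MatchingFactory.matchingPoly r π x /
            ∑ σ : Equiv.Perm (Fin n), MatchingFactory.matchingPoly r σ x) ∧
    -- it is a Bernoulli factory for the Birkhoff polytope
    MatchingFactory.IsBernoulliFactoryFor
      (doublyStochastic ℝ (Fin n) : Set (Matrix (Fin n) (Fin n) ℝ))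
      (fun π : Equiv.Perm (Fin n) => π.permMatrix ℝ)
      (MatchingFactory.matchingFactory r) :=
  ⟨fun _ hx => MatchingFactory.sum_matchingPoly_smul_sub r hx,
    fun _ hx hpos π => MatchingFactory.prob_matchingFactory r hx hpos π,
    MatchingFactory.isBernoulliFactoryFor_matchingFactory r⟩
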